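/- Let $M$ be a smooth $n$-dimensional manifold, $g$ a smooth pseudo-Riemannian metric on $M$, and $TM=(V_{p_1}\oplus V_{p_1^*})\stackrel{\perp}{\oplus}V_{q_1}$ a Witt structure, that is: $V_{p_1},V_{p_1^*},V_{q_1}$ are smooth subbundles, $V_{p_1}\oplus V_{p_1^*}$ and $V_{q_1}$ are $g$-orthogonal, $V_{p_1}$ and $V_{p_1^*}$ have the same rank, are totally isotropic and are non-degenerately paired by $g$, and $V_{q_1}$ is anisotropic. Assume that $g$ is positive definite on $V_{q_1}$ and that $V_{p_1},V_{p_1^*}$ are line bundles spanned by global smooth vector fields $\xi\in\Gamma(V_{p_1})$, $\xi^*\in\Gamma(V_{p_1^*})$ with $g(\xi,\xi^*)=1$ (so $g$ is Lorentzian). Put $\sigma=(\xi^*)^\flat=g(\xi^*,\cdot)$ and $\sigma^*=\xi^\flat=g(\xi,\cdot)$. Put $q_1^*=q_1$, $(p_1^*)^*=p_1$, and write $X_k$ for the $V_k$-component of a vector $X$, and let $\flat,\sharp$ be the musical isomorphisms of $g$. The canonical Witt connection $\nabla$ is the connection on $TM$ with $\nabla g=0$ that preserves each $V_i$, $i\in\{q_1,p_1,p_1^*\}$,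 and whose torsion is $$T(X_i,Y_j)=-\sum_{k\ne i,j}[X_i,Y_j]_k+\tau^j(X_i,Y_j)-\tau^i(Y_j,X_i),\qquad X_i\in\Gamma(V_i),\ Y_j\in\Gamma(V_j),$$ where $\tau^j(X_i,Y_j)=0$ if $i=j$, where $$\tau^j(X_i,Y_j)=\tfrac12\Bigl((\mathcal L_{X_i}Y_j^\flat+\mathcal L_{Y_j}X_i^\flat)^\sharp_j-[X_i,Y_j]_j-(d(g(X_i,Y_j)))^\sharp_j\Bigr)$$ if $i\ne j$ and $i=j^*$, and where $$\tau^j(X_i,Y_j)=\tfrac12\Bigl((\mathcal L_{X_i}Y_j^\flat)^\sharp_j-[X_i,Y_j]_j\Bigr)$$ if $i\ne j$ and $i\ne j^*$. Let $c:[0,1]\to M$ be a smooth curve with $\dot c(t)\in V_{p_1}\oplus V_{p_1^*}$ and $g(\dot c(t),\dot c(t))=0$ for all $t\in[0,1]$. Then $c$ is a lightlike $\nabla$-geodesic (that is, in addition, $\nabla_{\dot c}\dot c=0$ on $[0,1]$) if and only if, on $[0,1]$, $$(\mathcal L_{\dot c}\sigma)(\dot c)-\sigma(\dot c)\,(\mathcal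 L_{\xi^*}\sigma^*)(\dot c)=0\quad\text{and}\quad(\mathcal L_{\dot c}\sigma^*)(\dot c)-\sigma^*(\dot c)\,(\mathcal L_{\xi}\sigma)(\dot c)=0,$$ where $(\mathcal L_{\dot c}\theta)(\dot c)=\frac{d}{dt}\bigl(\theta(\dot c)\bigr)$ for a one-form $\theta$. -/

import Mathlib

open scoped Manifold ContDiff Bundle
open Bundle

noncomputable section

namespace WittGeometry

/-! ### Index set of a Witt structure -/

/-- The index set `{q_1, …, q_r} ∪ {p_1, p_1*, …, p_s, p_s*}`. -/
inductive WittIndex (r s : ℕ) : Type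
  | q (l : Fin r) : WittIndex r s
  | p (k : Fin s) : WittIndex r s
  | pStar (k : Fin s) : WittIndex r s
  deriving DecidableEq, Fintype

/-- The involution `i ↦ i*` with `q_l* = q_l` and `p_k ↔ p_k*`. -/
def WittIndex.dual {r s : ℕ} : WittIndex r s → WittIndex r s
  | .q l => .q l
  | .p k => .pStar k
  | .pStar k => .p k

section Manifold

variable {n : ℕ} {M : Type*} [TopologicalSpace M] [ChartedSpace (EuclideanSpace ℝ (Fin n)) M]
  [IsManifold (𝓡 n) ∞ M]

/-! ### Vector fields and one-forms -/

/-- A smooth vector field on `M`. -/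
def IsSmoothField (X : Π x : M, TangentSpace (𝓡 n) x) : Prop :=
  ContMDiff (𝓡 n) (𝓡 n).tangent ∞
    (fun x ↦ (TotalSpace.mk' (EuclideanSpace ℝ (Fin n)) x (X x) : TangentBundle (𝓡 n) M))

/-- The vector field `Z` is differentiable at `x`. -/
abbrev DiffFieldAt (Z : Π x : M, TangentSpace (𝓡 n) x) (x : M) : Prop :=
  MDifferentiableAt (𝓡 n) (𝓡 n).tangent
    (fun y ↦ (TotalSpace.mk' (EuclideanSpace ℝ (Fin n)) y (Z y) : TangentBundle (𝓡 n) M)) x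

/-- Lie derivative of the one-form `θ` along the vector field `X`, at `x`, as a covector:
`(L_X θ)(Z) = X(θ(Z)) - θ([X, Z])`. The right-hand side depends only on `Z x` whenever `θ` is
differentiable at `x` (see `lieDerivForm_apply`); where it does not, the value is `0`. -/
def lieDerivForm (X : Π x : M, TangentSpace (𝓡 n) x) (θ : Π x : M, TangentSpace (𝓡 n) x →L[ℝ] ℝ)
    (x : M) : TangentSpace (𝓡 n) x →L[ℝ] ℝ :=
  open Classical in
  if h : TensorialAt (𝓡 n) (EuclideanSpace ℝ (Fin n))
      (fun Z : Π y : M, TangentSpace (𝓡 n) y ↦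
        mvfderiv (𝓡 n) (fun y ↦ θ y (Z y)) x (X x) -
          θ x (VectorField.mlieBracket (𝓡 n) X Z x)) x
  then TensorialAt.mkHom _ x h
  else 0

/-- Well-definedness of `lieDerivForm` for a one-form `θ` that is differentiable at `x`, in the
sense that it maps fields differentiable at `x` to functions differentiable at `x`. -/
theorem lieDerivForm_apply {X Z : Π x : M, TangentSpace (𝓡 n) x}
    {θ : Π x : M, TangentSpace (𝓡 n) x →L[ℝ] ℝ} {x : M}
    (hθ : ∀ Z : Π x : M, TangentSpace (𝓡 n) x, DiffFieldAt Z x →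
      MDifferentiableAt (𝓡 n) 𝓘(ℝ, ℝ) (fun y ↦ θ y (Z y)) x)
    (hZ : DiffFieldAt Z x) :
    lieDerivForm X θ x (Z x) = mvfderiv (𝓡 n) (fun y ↦ θ y (Z y)) x (X x) -
      θ x (VectorField.mlieBracket (𝓡 n) X Z x) := by
  have h : TensorialAt (𝓡 n) (EuclideanSpace ℝ (Fin n))
      (fun Z : Π y : M, TangentSpace (𝓡 n) y ↦
        mvfderiv (𝓡 n) (fun y ↦ θ y (Z y)) x (X x) -
          θ x (VectorField.mlieBracket (𝓡 n) X Z x)) x :=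
    { smul := by
        intro f Y hf hY
        have h1 : (fun y ↦ θ y ((f • Y) y)) = f * (fun y ↦ θ y (Y y)) := by
          ext y; simp
        rw [h1, mvfderiv_mul hf (hθ Y hY), VectorField.mlieBracket_smul_right hf hY]
        simp
        ring
      add := by
        intro Y Y' hY hY'
        have h1 : (fun y ↦ θ y ((Y + Y') y)) = (fun y ↦ θ y (Y y)) + (fun y ↦ θ y (Y' y)) := by
          ext y; simp
        rw [h1, mvfderiv_add (hθ Y hY) (hθ Y' hY'), VectorField.mlieBracket_add_right hY hY']
        simp
        ring }
  rw [lieDerivForm, dif_pos h]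
  exact TensorialAt.mkHom_apply h hZ

/-! ### Pseudo-Riemannian metrics -/

variable (n M) in
/-- A smooth pseudo-Riemannian metric: a smooth symmetric non-degenerate `(0,2)`-tensor field. -/
structure PseudoRiemannianMetric where
  /-- The bilinear form on each tangent space. -/
  form (x : M) : TangentSpace (𝓡 n) x →L[ℝ] TangentSpace (𝓡 n) x →L[ℝ] ℝ
  symm (x : M) (v w : TangentSpace (𝓡 n) x) : form x v w = form x w v
  nondegenerate (x : M) (v : TangentSpace (𝓡 n) x) (hv : ∀ w, form x v w = 0) : v = 0
  contMDiff : ContMDiff (𝓡 n)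
    ((𝓡 n).prod 𝓘(ℝ, EuclideanSpace ℝ (Fin n) →L[ℝ] EuclideanSpace ℝ (Fin n) →L[ℝ] ℝ)) ∞
    (fun x ↦ TotalSpace.mk' (EuclideanSpace ℝ (Fin n) →L[ℝ] EuclideanSpace ℝ (Fin n) →L[ℝ] ℝ) x
      (form x))

namespace PseudoRiemannianMetric

variable (g : PseudoRiemannianMetric n M)

/-- The one-form `Z♭ = g(Z, ·)`. -/
def flat (Z : Π x : M, TangentSpace (𝓡 n) x) (x : M) : TangentSpace (𝓡 n) x →L[ℝ] ℝ :=
  g.form x (Z x)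

theorem exists_sharp (x : M) (θ : TangentSpace (𝓡 n) x →L[ℝ] ℝ) :
    ∃ v : TangentSpace (𝓡 n) x, ∀ w, g.form x v w = θ w := by
  have : FiniteDimensional ℝ (TangentSpace (𝓡 n) x) :=
    inferInstanceAs (FiniteDimensional ℝ (EuclideanSpace ℝ (Fin n)))
  let f : TangentSpace (𝓡 n) x →ₗ[ℝ] Module.Dual ℝ (TangentSpace (𝓡 n) x) :=
    (ContinuousLinearMap.coeLM ℝ).comp (g.form x).toLinearMap
  have hf : Function.Injective f := by
    rw [← LinearMap.ker_eq_bot, LinearMap.ker_eq_bot']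
    intro v hv
    exact g.nondegenerate x v fun w ↦ LinearMap.congr_fun hv w
  have hs : Function.Surjective f :=
    (LinearMap.injective_iff_surjective_of_finrank_eq_finrank
      (Subspace.dual_finrank_eq (K := ℝ)).symm).1 hf
  obtain ⟨v, hv⟩ := hs θ.toLinearMap
  exact ⟨v, fun w ↦ LinearMap.congr_fun hv w⟩

/-- The vector `θ♯` with `g(θ♯, ·) = θ`. -/
def sharp (x : M) (θ : TangentSpace (𝓡 n) x →L[ℝ] ℝ) : TangentSpace (𝓡 n) x :=
  (g.exists_sharp x θ).choose

theorem form_sharp (x : M) (θ : TangentSpace (𝓡 n) x →L[ℝ] ℝ) (w : TangentSpace (𝓡 n) x) :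
    g.form x (g.sharp x θ) w = θ w :=
  (g.exists_sharp x θ).choose_spec w

/-- Hence `Z♭` satisfies the hypothesis of `lieDerivForm_apply` for every smooth field `Z`. -/
theorem mdifferentiableAt_form {Y Z : Π x : M, TangentSpace (𝓡 n) x} {x : M}
    (hY : DiffFieldAt Y x) (hZ : DiffFieldAt Z x) :
    MDifferentiableAt (𝓡 n) 𝓘(ℝ, ℝ) (fun y ↦ g.form y (Y y) (Z y)) x := by
  have hg := (g.contMDiff x).mdifferentiableAt (by simp)
  have h : MDifferentiableAt (𝓡 n) ((𝓡 n).prod 𝓘(ℝ, ℝ))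
      (fun y ↦ TotalSpace.mk' ℝ (E := Bundle.Trivial M ℝ) y (g.form y (Y y) (Z y))) x := by
    apply MDifferentiableAt.clm_bundle_apply₂ (F₁ := EuclideanSpace ℝ (Fin n))
      (F₂ := EuclideanSpace ℝ (Fin n))
    · exact hg
    · exact hY
    · exact hZ
  simp only [mdifferentiableAt_totalSpace] at h
  exact h.2

end PseudoRiemannianMetric

/-! ### Witt structures -/

/-- `V` is a smooth subbundle of rank `m` of `TM`: locally it has a smooth frame of `m` fields. -/
def IsSmoothSubbundle (V : Π x : M, Submodule ℝ (TangentSpace (𝓡 n) x)) (m : ℕ) : Prop :=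
  ∀ x₀ : M, ∃ U : Set M, IsOpen U ∧ x₀ ∈ U ∧ ∃ e : Fin m → Π x : M, TangentSpace (𝓡 n) x,
    (∀ a, ContMDiffOn (𝓡 n) (𝓡 n).tangent ∞
      (fun x ↦ (TotalSpace.mk' (EuclideanSpace ℝ (Fin n)) x (e a x) : TangentBundle (𝓡 n) M)) U) ∧
    ∀ x ∈ U, LinearIndependent ℝ (fun a ↦ e a x) ∧
      Submodule.span ℝ (Set.range fun a ↦ e a x) = V x

/-- A Witt structure on `(M, g)`, with `s` hyperbolic pairs `V_{p_k} ⊕ V_{p_k*}` and `r`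
anisotropic summands `V_{q_l}`. -/
structure WittStructure (g : PseudoRiemannianMetric n M) (r s : ℕ) where
  /-- The subbundles `V_i`. -/
  V (i : WittIndex r s) (x : M) : Submodule ℝ (TangentSpace (𝓡 n) x)
  /-- Their ranks. -/
  rank : WittIndex r s → ℕ
  isSmoothSubbundle (i : WittIndex r s) : IsSmoothSubbundle (V i) (rank i)
  isInternal (x : M) : DirectSum.IsInternal fun i ↦ V i x
  /-- The blocks `V_{p_k} ⊕ V_{p_k*}` and `V_{q_l}` are mutually orthogonal. -/
  orthogonal (i j : WittIndex r s) (hj : j ≠ i) (hj' : j ≠ i.dual) (x : M)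
    (v w : TangentSpace (𝓡 n) x) (hv : v ∈ V i x) (hw : w ∈ V j x) : g.form x v w = 0
  rank_dual (i : WittIndex r s) : rank i.dual = rank i
  /-- `V_{p_k}` and `V_{p_k*}` are totally isotropic. -/
  isotropic (i : WittIndex r s) (hi : i.dual ≠ i) (x : M) (v w : TangentSpace (𝓡 n) x)
    (hv : v ∈ V i x) (hw : w ∈ V i x) : g.form x v w = 0
  /-- The pairing of `V_{p_k}` with `V_{p_k*}` is non-degenerate (on both sides). -/
  pairing_nondegenerate (i : WittIndex r s) (hi : i.dual ≠ i) (x : M) (v : TangentSpace (𝓡 n) x)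
    (hv : v ∈ V i x) (h : ∀ w ∈ V i.dual x, g.form x v w = 0) : v = 0
  /-- `V_{q_l}` is anisotropic. -/
  anisotropic (l : Fin r) (x : M) (v : TangentSpace (𝓡 n) x) (hv : v ∈ V (.q l) x)
    (h : g.form x v v = 0) : v = 0

namespace WittStructure

variable {g : PseudoRiemannianMetric n M} {r s : ℕ} (W : WittStructure g r s)

/-- A smooth section of `V_i`. -/
def IsSection (i : WittIndex r s) (X : Π x : M, TangentSpace (𝓡 n) x) : Prop :=
  IsSmoothField X ∧ ∀ x, X x ∈ W.V i x

/-- The projection `π^i_x` of `T_x M = ⊕_k V_{k,x}` onto `V_{i,x}`: `W.proj i x v` is the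
component `v_i`. -/
def proj (i : WittIndex r s) (x : M) (v : TangentSpace (𝓡 n) x) : TangentSpace (𝓡 n) x :=
  ((LinearEquiv.ofBijective (DirectSum.coeLinearMap fun k ↦ W.V k x) (W.isInternal x)).symm v) i

/-- The component of `v` in `(V_{i*} + V_{j*})^⊥`, which is the sum of the `V_k` with `k ≠ i` and
`k ≠ j`. -/
def projPerp (i j : WittIndex r s) (x : M) (v : TangentSpace (𝓡 n) x) : TangentSpace (𝓡 n) x :=
  ∑ k with k ≠ i ∧ k ≠ j, W.proj k x v

/-- The vector `τ^k(X_i, Y_j)` at `x`, for sections `X_i` of `V_i` and `Y_j` of `V_j`. -/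
def tau (k i j : WittIndex r s) (X Y : Π x : M, TangentSpace (𝓡 n) x) (x : M) :
    TangentSpace (𝓡 n) x :=
  if i = j ∨ j ≠ k then 0
  else if i = j.dual then
    (1 / 2 : ℝ) •
      (W.proj k x (g.sharp x (lieDerivForm X (g.flat Y) x + lieDerivForm Y (g.flat X) x)) -
        W.proj k x (VectorField.mlieBracket (𝓡 n) X Y x) -
        W.proj k x (g.sharp x (mvfderiv (𝓡 n) (fun y ↦ g.form y (X y) (Y y)) x)))
  else
    (1 / 2 : ℝ) •
      (W.proj k x (g.sharp x (lieDerivForm X (g.flat Y) x)) -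
        W.proj k x (VectorField.mlieBracket (𝓡 n) X Y x))

/-- `∇` is a Witt connection: it preserves the metric and every subbundle `V_i`. -/
structure IsWittConnection
    (nabla : CovariantDerivative (𝓡 n) (EuclideanSpace ℝ (Fin n))
      (TangentSpace (𝓡 n) : M → Type _)) : Prop where
  metric (Y Z : Π x : M, TangentSpace (𝓡 n) x) (hY : IsSmoothField Y) (hZ : IsSmoothField Z)
    (x : M) (v : TangentSpace (𝓡 n) x) :
    mvfderiv (𝓡 n) (fun y ↦ g.form y (Y y) (Z y)) x v =
      g.form x (nabla Y x v) (Z x) + g.form x (Y x) (nabla Z x v)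
  preserves (i : WittIndex r s) (Y : Π x : M, TangentSpace (𝓡 n) x) (hY : W.IsSection i Y)
    (x : M) (v : TangentSpace (𝓡 n) x) : nabla Y x v ∈ W.V i x

/-- `∇` is the canonical Witt connection: the Witt connection whose torsion is
`T(X_i, Y_j) = -[X_i, Y_j]_{(V_{i*} + V_{j*})^⊥} + τ^j(X_i, Y_j) - τ^i(Y_j, X_i)`
for sections `X_i` of `V_i` and `Y_j` of `V_j`. These conditions determine `∇` on smooth fields. -/
structure IsCanonicalWittConnection
    (nabla : CovariantDerivative (𝓡 n) (EuclideanSpace ℝ (Fin n))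
      (TangentSpace (𝓡 n) : M → Type _)) : Prop extends W.IsWittConnection nabla where
  torsion_eq (i j : WittIndex r s) (X Y : Π x : M, TangentSpace (𝓡 n) x)
    (hX : W.IsSection i X) (hY : W.IsSection j Y) (x : M) :
    nabla.torsion x (X x) (Y x) =
      -W.projPerp i j x (VectorField.mlieBracket (𝓡 n) X Y x) + W.tau j i j X Y x -
        W.tau i j i Y X x

/-- `(ξ, ξ*)` is a global smooth frame of the null line bundles `V_{p_1}`, `V_{p_1*}` with
`g(ξ, ξ*) = 1`. -/
structure IsNullFrame (W : WittStructure g 1 1) (ξ ξs : Π x : M, TangentSpace (𝓡 n) x) : Prop where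
  smooth : IsSmoothField ξ
  smooth_star : IsSmoothField ξs
  span (x : M) : W.V (.p 0) x = Submodule.span ℝ {ξ x}
  span_star (x : M) : W.V (.pStar 0) x = Submodule.span ℝ {ξs x}
  normalized (x : M) : g.form x (ξ x) (ξs x) = 1

end WittStructure

/-! ### Curves `c : [0,1] → M` -/

/-- The velocity `ċ(t)` of a curve on `[0,1]` (one-sided at the end points). -/
def velocity (c : ℝ → M) (t : ℝ) : TangentSpace (𝓡 n) (c t) :=
  mfderivWithin 𝓘(ℝ, ℝ) (𝓡 n) c (Set.Icc 0 1) t (1 : ℝ)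

/-- Covariant derivative `∇_ċ Y` at time `t` of a vector field `Y` along `c`. In the trivialization
of `TM` given by the chart at `c t`, with coordinate frame `(e_a)` and `Y = ∑ Y^a e_a` along `c`, it
is `∑ (Y^a)'(t) e_a + ∑ Y^a(t) ∇_{ċ(t)} e_a`; `FiberBundle.extend` is the local vector field with
the constant coefficients `Y^a(t)`. -/
def covDerivAlong
    (nabla : CovariantDerivative (𝓡 n) (EuclideanSpace ℝ (Fin n))
      (TangentSpace (𝓡 n) : M → Type _))
    (c : ℝ → M) (Y : Π t : ℝ, TangentSpace (𝓡 n) (c t)) (t : ℝ) : TangentSpace (𝓡 n) (c t) :=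
  (trivializationAt (EuclideanSpace ℝ (Fin n)) (TangentSpace (𝓡 n)) (c t)).symm (c t)
      (derivWithin (fun u ↦ (trivializationAt (EuclideanSpace ℝ (Fin n)) (TangentSpace (𝓡 n)) (c t)
        (TotalSpace.mk' (EuclideanSpace ℝ (Fin n)) (c u) (Y u))).2) (Set.Icc 0 1) t) +
    nabla (FiberBundle.extend (EuclideanSpace ℝ (Fin n)) (Y t)) (c t) (velocity c t)

/-- `(L_ċ θ)(ċ) = ċ(θ(ċ)) - θ([ċ, ċ]) = ċ(θ(ċ))` at time `t`, for a one-form `θ` on `M`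
(see `lieDerivForm_eq_lieDerivSelf`). -/
def lieDerivSelf (c : ℝ → M) (θ : Π x : M, TangentSpace (𝓡 n) x →L[ℝ] ℝ) (t : ℝ) : ℝ :=
  derivWithin (fun u ↦ θ (c u) (velocity c u)) (Set.Icc 0 1) t

/-- If a vector field `X` extends `ċ`, then `(L_X θ)(X)` is `lieDerivSelf c θ` along `c`. -/
theorem lieDerivForm_eq_lieDerivSelf {X : Π x : M, TangentSpace (𝓡 n) x}
    {θ : Π x : M, TangentSpace (𝓡 n) x →L[ℝ] ℝ} {c : ℝ → M} {t : ℝ} (ht : t ∈ Set.Icc (0 : ℝ) 1)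
    (hθ : ∀ Z : Π x : M, TangentSpace (𝓡 n) x, DiffFieldAt Z (c t) →
      MDifferentiableAt (𝓡 n) 𝓘(ℝ, ℝ) (fun y ↦ θ y (Z y)) (c t))
    (hX : DiffFieldAt X (c t))
    (hc : MDifferentiableWithinAt 𝓘(ℝ, ℝ) (𝓡 n) c (Set.Icc 0 1) t)
    (hcX : ∀ u ∈ Set.Icc (0 : ℝ) 1, X (c u) = velocity c u) :
    lieDerivForm X θ (c t) (velocity c t) = lieDerivSelf c θ t := by
  have hu : UniqueDiffWithinAt ℝ (Set.Icc (0 : ℝ) 1) t := uniqueDiffOn_Icc one_pos t ht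
  have h1 : lieDerivSelf c θ t =
      derivWithin ((fun y ↦ θ y (X y)) ∘ c) (Set.Icc 0 1) t := by
    apply derivWithin_congr
    · intro u hu
      simp [hcX u hu]
    · simp [hcX t ht]
  have h2 : mfderivWithin 𝓘(ℝ, ℝ) 𝓘(ℝ, ℝ) ((fun y ↦ θ y (X y)) ∘ c) (Set.Icc 0 1) t (1 : ℝ) =
      mfderiv (𝓡 n) 𝓘(ℝ, ℝ) (fun y ↦ θ y (X y)) (c t) (velocity c t) := by
    rw [mfderiv_comp_mfderivWithin t (hθ X hX) hc hu.uniqueMDiffWithinAt]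
    rfl
  rw [← hcX t ht, lieDerivForm_apply hθ hX, VectorField.mlieBracket_self, h1, hcX t ht]
  rw [mfderivWithin_eq_fderivWithin] at h2
  simp only [Pi.zero_apply, map_zero, sub_zero]
  rw [← fderivWithin_derivWithin]
  exact h2.symm

/-- `c : [0,1] → M` is a `∇`-geodesic: `∇_ċ ċ = 0`. -/
def IsGeodesic
    (nabla : CovariantDerivative (𝓡 n) (EuclideanSpace ℝ (Fin n))
      (TangentSpace (𝓡 n) : M → Type _)) (c : ℝ → M) : Prop :=
  ∀ t ∈ Set.Icc (0 : ℝ) 1, covDerivAlong nabla c (velocity c) t = 0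

/-- A lightlike `∇`-geodesic: a `∇`-geodesic with `ċ ∈ V_{p_1} ⊕ V_{p_1*}` and `g(ċ, ċ) = 0`. -/
def WittStructure.IsLightlikeGeodesic {g : PseudoRiemannianMetric n M} (W : WittStructure g 1 1)
    (nabla : CovariantDerivative (𝓡 n) (EuclideanSpace ℝ (Fin n))
      (TangentSpace (𝓡 n) : M → Type _)) (c : ℝ → M) : Prop :=
  IsGeodesic nabla c ∧
    (∀ t ∈ Set.Icc (0 : ℝ) 1, velocity c t ∈ W.V (.p 0) (c t) ⊔ W.V (.pStar 0) (c t)) ∧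
    ∀ t ∈ Set.Icc (0 : ℝ) 1, g.form (c t) (velocity c t) (velocity c t) = 0

end Manifold

end WittGeometry

end

namespace WittGeometry

section

variable {n : ℕ} {M : Type*} [TopologicalSpace M] [ChartedSpace (EuclideanSpace ℝ (Fin n)) M]
  [IsManifold (𝓡 n) ∞ M]

/-! Write `ċ = a ξ + b ξ*` with `a = σ(ċ)`, `b = σ*(ċ)`. Since `∇` preserves the two null lines and
`g(ξ, ξ*) = 1` is constant, one form `κ = g(ξ, ∇ξ*)` describes it there: `∇ξ* = κ ξ*` and `∇ξ = -κ
ξ`. The Leibniz rule (`covDerivAlong_smul_add_smul`) gives `∇_ċ ċ = (a' - a κ(ċ)) ξ + (b' + b κ(ċ))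
ξ*`. The torsion has no component in the null plane (`form_torsion`), so `κ(ξ) = (L_{ξ*} σ*)(ξ)` and
`-κ(ξ*) = (L_ξ σ)(ξ*)` (`form_nabla_dual`), while `(L_{ξ*} σ*)(ξ*)` and `(L_ξ σ)(ξ)` vanish
(`lieDerivForm_dual_self`). The two equations are therefore `a' - a² κ(ξ) = 0` and `b' + b² κ(ξ*) =
0`. They differ from the geodesic equations only by multiples of `a b`, and `a b = 0` because `0 =
g(ċ, ċ) = 2ab`. -/

theorem one_add_one_le_infty : (1 + 1 : WithTop ℕ∞) ≤ ∞ := by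
  rw [one_add_one_eq_two]
  exact ENat.LEInfty.out

/-! ### Covariant derivatives of fields on `M` and of fields along a curve. -/

theorem IsSmoothField.diffFieldAt {X : Π x : M, TangentSpace (𝓡 n) x} (hX : IsSmoothField X)
    (x : M) : DiffFieldAt X x :=
  (hX x).mdifferentiableAt (by simp)

/-- A covariant derivative is the coordinate derivative plus the covariant derivative of the
extension with constant coefficients. -/
theorem covariantDerivative_eq_add_extend
    (nabla : CovariantDerivative (𝓡 n) (EuclideanSpace ℝ (Fin n))
      (TangentSpace (𝓡 n) : M → Type _))
    {Z : Π x : M, TangentSpace (𝓡 n) x} {x : M} (hZ : DiffFieldAt Z x)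
    (v : TangentSpace (𝓡 n) x) :
    nabla Z x v =
      (trivializationAt (EuclideanSpace ℝ (Fin n)) (TangentSpace (𝓡 n)) x).symmL ℝ x
        (mvfderiv (𝓡 n) (fun y ↦ (trivializationAt (EuclideanSpace ℝ (Fin n))
          (TangentSpace (𝓡 n)) x (TotalSpace.mk' (EuclideanSpace ℝ (Fin n)) y (Z y))).2) x v) +
      nabla (FiberBundle.extend (EuclideanSpace ℝ (Fin n)) (Z x)) x v := by
  have : IsManifold (𝓡 n) 1 M := IsManifold.of_le (n := ∞) (by simp)
  have : IsManifold (𝓡 n) (1 + 1) M := IsManifold.of_le (n := ∞) one_add_one_le_infty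
  set e := trivializationAt (EuclideanSpace ℝ (Fin n)) (TangentSpace (𝓡 n) : M → Type _) x with he
  have hx : x ∈ e.baseSet := FiberBundle.mem_baseSet_trivializationAt' x
  have hbase : ∀ᶠ y in nhds x, y ∈ e.baseSet := e.open_baseSet.mem_nhds hx
  have hdiff {Y : Π y : M, TangentSpace (𝓡 n) y} (hY : DiffFieldAt Y x) :
      MDifferentiableAt (𝓡 n) 𝓘(ℝ, EuclideanSpace ℝ (Fin n))
        (fun y ↦ (e (TotalSpace.mk' (EuclideanSpace ℝ (Fin n)) y (Y y))).2) x :=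
    (e.mdifferentiableAt_section_iff (𝓡 n) Y hx).1 hY
  have hcongr {f f' : M → EuclideanSpace ℝ (Fin n)} (h : ∀ᶠ y in nhds x, f y = f' y) :
      mvfderiv (𝓡 n) f x = mvfderiv (𝓡 n) f' x := by
    have h' : f =ᶠ[nhds x] f' := h
    simp only [mvfderiv, h'.mfderiv_eq]
    rfl
  -- Both terms obey the same Leibniz rule, so their difference is tensorial and may be computed on
  -- any field with the same value at `x`, here the constant-coefficient extension.
  have hT : TensorialAt (𝓡 n) (EuclideanSpace ℝ (Fin n))
      (fun Y : Π y : M, TangentSpace (𝓡 n) y ↦ nabla Y x v - e.symmL ℝ x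
        (mvfderiv (𝓡 n)
          (fun y ↦ (e (TotalSpace.mk' (EuclideanSpace ℝ (Fin n)) y (Y y))).2) x v)) x :=
    { smul := by
        intro f Y hf hY
        have h1 : mvfderiv (𝓡 n)
            (fun y ↦ (e (TotalSpace.mk' (EuclideanSpace ℝ (Fin n)) y ((f • Y) y))).2) x =
            mvfderiv (𝓡 n)
              (f • (fun y ↦ (e (TotalSpace.mk' (EuclideanSpace ℝ (Fin n)) y (Y y))).2)) x := by
          apply hcongr
          filter_upwards [hbase] with y hy
          exact (e.linear ℝ hy).map_smul (f y) (Y y)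
        have h2 : e.symmL ℝ x (e (TotalSpace.mk' (EuclideanSpace ℝ (Fin n)) x (Y x))).2 = Y x := by
          have := e.symmL_continuousLinearMapAt (R := ℝ) hx (Y x)
          rwa [e.continuousLinearMapAt_apply_of_mem ℝ hx] at this
        rw [h1, mvfderiv_smul hf (hdiff hY),
          nabla.isCovariantDerivativeOnUniv.leibniz hY hf]
        simp [h2]
        module
      add := by
        intro Y Y' hY hY'
        have h1 : mvfderiv (𝓡 n)
            (fun y ↦ (e (TotalSpace.mk' (EuclideanSpace ℝ (Fin n)) y ((Y + Y') y))).2) x =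
            mvfderiv (𝓡 n)
              ((fun y ↦ (e (TotalSpace.mk' (EuclideanSpace ℝ (Fin n)) y (Y y))).2) +
              (fun y ↦ (e (TotalSpace.mk' (EuclideanSpace ℝ (Fin n)) y (Y' y))).2)) x := by
          apply hcongr
          filter_upwards [hbase] with y hy
          exact (e.linear ℝ hy).map_add (Y y) (Y' y)
        rw [h1, mvfderiv_add (hdiff hY) (hdiff hY'),
          nabla.isCovariantDerivativeOnUniv.add hY hY']
        simp
        module }
  have hE := FiberBundle.mdifferentiableAt_extend (𝓡 n) (EuclideanSpace ℝ (Fin n)) (Z x)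
  have h := hT.pointwise hZ hE (by simp)
  have h0 : mvfderiv (𝓡 n) (fun y ↦ (e (TotalSpace.mk' (EuclideanSpace ℝ (Fin n)) y
      (FiberBundle.extend (EuclideanSpace ℝ (Fin n)) (Z x) y))).2) x = 0 := by
    rw [← mvfderiv_const (I := 𝓡 n)
      ((e (TotalSpace.mk' (EuclideanSpace ℝ (Fin n)) x (Z x))).2) (x := x)]
    apply hcongr
    filter_upwards [hbase] with y hy
    simp only [FiberBundle.extend]
    rw [← he, e.apply_mk_symm hy]
  simp only [h0] at h
  rw [sub_eq_iff_eq_add] at h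
  rw [h]
  simp
  module

/-- The velocity is the tangent map of `c` applied to the unit field on `[0,1]`. Unique
differentiability of the interval includes the end points. -/
theorem mdifferentiableWithinAt_velocity {c : ℝ → M}
    (hc : ContMDiffOn 𝓘(ℝ, ℝ) (𝓡 n) ∞ c (Set.Icc 0 1)) {t : ℝ} (ht : t ∈ Set.Icc (0 : ℝ) 1) :
    MDifferentiableWithinAt 𝓘(ℝ, ℝ) (𝓡 n).tangent
      (fun u ↦ (TotalSpace.mk' (EuclideanSpace ℝ (Fin n)) (c u) (velocity c u) :
        TangentBundle (𝓡 n) M)) (Set.Icc 0 1) t := by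
  have : IsManifold (𝓡 n) 1 M := IsManifold.of_le (n := ∞) (by simp)
  have hu : UniqueMDiffOn 𝓘(ℝ, ℝ) (Set.Icc (0 : ℝ) 1) :=
    (uniqueDiffOn_Icc one_pos).uniqueMDiffOn
  have h1 : ContMDiffOn 𝓘(ℝ, ℝ).tangent (𝓡 n).tangent 1
      (tangentMapWithin 𝓘(ℝ, ℝ) (𝓡 n) c (Set.Icc 0 1))
      (TotalSpace.proj ⁻¹' Set.Icc (0 : ℝ) 1) :=
    hc.contMDiffOn_tangentMapWithin (m := 1) one_add_one_le_infty hu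
  have h2 : ContMDiff 𝓘(ℝ, ℝ) 𝓘(ℝ, ℝ).tangent 1
      (fun u : ℝ ↦ (TotalSpace.mk' ℝ u (1 : TangentSpace 𝓘(ℝ, ℝ) u) :
        TangentBundle 𝓘(ℝ, ℝ) ℝ)) := by
    intro u
    refine (contMDiffAt_section _).2 ?_
    simp only [trivializationAt_model_space_apply]
    exact contMDiffAt_const
  have h3 := h1.comp (s := Set.Icc (0 : ℝ) 1) h2.contMDiffOn (fun u hu ↦ hu)
  exact (h3 t ht).mdifferentiableWithinAt (by simp)

namespace PseudoRiemannianMetric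

theorem differentiableWithinAt_form_velocity (g : PseudoRiemannianMetric n M)
    {X : Π x : M, TangentSpace (𝓡 n) x} (hX : IsSmoothField X) {c : ℝ → M}
    (hc : ContMDiffOn 𝓘(ℝ, ℝ) (𝓡 n) ∞ c (Set.Icc 0 1)) {t : ℝ} (ht : t ∈ Set.Icc (0 : ℝ) 1) :
    DifferentiableWithinAt ℝ (fun u ↦ g.form (c u) (X (c u)) (velocity c u))
      (Set.Icc 0 1) t := by
  have hct : MDifferentiableWithinAt 𝓘(ℝ, ℝ) (𝓡 n) c (Set.Icc 0 1) t :=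
    (hc t ht).mdifferentiableWithinAt (by simp)
  have hg := ((g.contMDiff (c t)).mdifferentiableAt (by simp)).comp_mdifferentiableWithinAt t hct
  have hXc := (hX.diffFieldAt (c t)).comp_mdifferentiableWithinAt t hct
  have h : MDifferentiableWithinAt 𝓘(ℝ, ℝ) ((𝓡 n).prod 𝓘(ℝ, ℝ))
      (fun u ↦ TotalSpace.mk' ℝ (E := Bundle.Trivial M ℝ) (c u)
        (g.form (c u) (X (c u)) (velocity c u))) (Set.Icc 0 1) t := by
    apply MDifferentiableWithinAt.clm_bundle_apply₂ (F₁ := EuclideanSpace ℝ (Fin n))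
      (F₂ := EuclideanSpace ℝ (Fin n))
    · exact hg
    · exact hXc
    · exact mdifferentiableWithinAt_velocity hc ht
  simp only [mdifferentiableWithinAt_totalSpace] at h
  exact mdifferentiableWithinAt_iff_differentiableWithinAt.1 h.2

end PseudoRiemannianMetric

/-- Leibniz rule for a vector field along `c` expanded in two ambient fields. -/
theorem covDerivAlong_smul_add_smul
    (nabla : CovariantDerivative (𝓡 n) (EuclideanSpace ℝ (Fin n))
      (TangentSpace (𝓡 n) : M → Type _))
    {X Z : Π x : M, TangentSpace (𝓡 n) x} {c : ℝ → M} {t : ℝ} (ht : t ∈ Set.Icc (0 : ℝ) 1)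
    (hc : MDifferentiableWithinAt 𝓘(ℝ, ℝ) (𝓡 n) c (Set.Icc 0 1) t)
    (hX : DiffFieldAt X (c t)) (hZ : DiffFieldAt Z (c t)) {a b : ℝ → ℝ}
    (ha : DifferentiableWithinAt ℝ a (Set.Icc 0 1) t)
    (hb : DifferentiableWithinAt ℝ b (Set.Icc 0 1) t)
    {Y : Π t : ℝ, TangentSpace (𝓡 n) (c t)}
    (hY : ∀ u ∈ Set.Icc (0 : ℝ) 1, Y u = a u • X (c u) + b u • Z (c u)) :
    covDerivAlong nabla c Y t =
      derivWithin a (Set.Icc 0 1) t • X (c t) + a t • nabla X (c t) (velocity c t) +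
      (derivWithin b (Set.Icc 0 1) t • Z (c t) + b t • nabla Z (c t) (velocity c t)) := by
  have : IsManifold (𝓡 n) 1 M := IsManifold.of_le (n := ∞) (by simp)
  have : IsManifold (𝓡 n) (1 + 1) M := IsManifold.of_le (n := ∞) one_add_one_le_infty
  have hu : UniqueDiffWithinAt ℝ (Set.Icc (0 : ℝ) 1) t := uniqueDiffOn_Icc one_pos t ht
  rw [covariantDerivative_eq_add_extend nabla hX, covariantDerivative_eq_add_extend nabla hZ]
  unfold covDerivAlong
  set e := trivializationAt (EuclideanSpace ℝ (Fin n)) (TangentSpace (𝓡 n) : M → Type _) (c t)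
    with he
  have hx : c t ∈ e.baseSet := FiberBundle.mem_baseSet_trivializationAt' (c t)
  have hbase : ∀ᶠ u in nhdsWithin t (Set.Icc 0 1), c u ∈ e.baseSet :=
    hc.continuousWithinAt (e.open_baseSet.mem_nhds hx)
  have hsymm {V : Π x : M, TangentSpace (𝓡 n) x} : e.symmL ℝ (c t)
      (e (TotalSpace.mk' (EuclideanSpace ℝ (Fin n)) (c t) (V (c t)))).2 = V (c t) := by
    have := e.symmL_continuousLinearMapAt (R := ℝ) hx (V (c t))
    rwa [e.continuousLinearMapAt_apply_of_mem ℝ hx] at this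
  -- Chain rule for the coordinates of an ambient field restricted to `c`.
  have hderiv {V : Π x : M, TangentSpace (𝓡 n) x} (hV : DiffFieldAt V (c t)) :
      HasDerivWithinAt
        (fun u ↦ (e (TotalSpace.mk' (EuclideanSpace ℝ (Fin n)) (c u) (V (c u)))).2)
        (mvfderiv (𝓡 n) (fun y ↦ (e (TotalSpace.mk' (EuclideanSpace ℝ (Fin n)) y (V y))).2)
          (c t) (velocity c t)) (Set.Icc 0 1) t := by
    have hV' := (e.mdifferentiableAt_section_iff (𝓡 n) V hx).1 hV
    have h := hasMFDerivWithinAt_iff_hasFDerivWithinAt.1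
      (hV'.hasMFDerivAt.comp_hasMFDerivWithinAt t hc.hasMFDerivWithinAt)
    have hL : ContinuousLinearMap.toSpanSingleton ℝ
        (mvfderiv (𝓡 n) (fun y ↦ (e (TotalSpace.mk' (EuclideanSpace ℝ (Fin n)) y (V y))).2)
          (c t) (velocity c t)) =
        (mfderiv (𝓡 n) 𝓘(ℝ, EuclideanSpace ℝ (Fin n))
          (fun y ↦ (e (TotalSpace.mk' (EuclideanSpace ℝ (Fin n)) y (V y))).2) (c t)).comp
          (mfderivWithin 𝓘(ℝ, ℝ) (𝓡 n) c (Set.Icc 0 1) t) :=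
      ContinuousLinearMap.ext_ring (by simp; rfl)
    rw [hasDerivWithinAt_iff_hasFDerivWithinAt, hL]
    exact h
  have hEq : (fun u ↦ (e (TotalSpace.mk' (EuclideanSpace ℝ (Fin n)) (c u) (Y u))).2)
      =ᶠ[nhdsWithin t (Set.Icc 0 1)] fun u ↦
        a u • (e (TotalSpace.mk' (EuclideanSpace ℝ (Fin n)) (c u) (X (c u)))).2 +
        b u • (e (TotalSpace.mk' (EuclideanSpace ℝ (Fin n)) (c u) (Z (c u)))).2 := by
    filter_upwards [hbase, self_mem_nhdsWithin] with u hu huI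
    rw [hY u huI]
    have hl := e.linear ℝ hu
    exact (hl.map_add _ _).trans (by rw [hl.map_smul, hl.map_smul])
  have hD := (ha.hasDerivWithinAt.smul (hderiv hX)).add (hb.hasDerivWithinAt.smul (hderiv hZ))
  -- The extension is linear in the vector only on the base set of `e`; this suffices because
  -- `nabla` is local.
  have hext : nabla (FiberBundle.extend (EuclideanSpace ℝ (Fin n)) (Y t)) (c t) =
      a t • nabla (FiberBundle.extend (EuclideanSpace ℝ (Fin n)) (X (c t))) (c t) +
      b t • nabla (FiberBundle.extend (EuclideanSpace ℝ (Fin n)) (Z (c t))) (c t) := by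
    have hE (w : TangentSpace (𝓡 n) (c t)) :=
      FiberBundle.mdifferentiableAt_extend (𝓡 n) (EuclideanSpace ℝ (Fin n)) w
    have h1 := (hE (X (c t))).smul_const_section (a := a t)
    have h2 := (hE (Z (c t))).smul_const_section (a := b t)
    rw [← nabla.isCovariantDerivativeOnUniv.smul_const (a t) (hE (X (c t))),
      ← nabla.isCovariantDerivativeOnUniv.smul_const (b t) (hE (Z (c t))),
      ← nabla.isCovariantDerivativeOnUniv.add h1 h2]
    apply nabla.isCovariantDerivativeOnUniv.congr_of_eventuallyEq (hE _)
      (mdifferentiableAt_add_section h1 h2) Filter.univ_mem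
    filter_upwards [e.open_baseSet.mem_nhds hx] with y hy
    have hl := e.linear ℝ hx
    simp only [FiberBundle.extend, ← he, Pi.add_apply, Pi.smul_apply, hY t ht]
    simp only [← e.symmL_apply (R := ℝ) hy]
    rw [← map_smul, ← map_smul, ← map_add]
    congr 1
    exact (hl.map_add _ _).trans (by rw [hl.map_smul, hl.map_smul])
  rw [hEq.derivWithin_eq_of_mem ht, ← e.symmL_apply (R := ℝ) hx, hext]
  have := hD.derivWithin hu
  simp only [Pi.add_def, Pi.smul_def'] at this
  rw [this]
  simp only [map_add, map_smul, hsymm]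
  simp
  module

/-! ### Lie derivatives, Witt components and torsion. -/

namespace PseudoRiemannianMetric

theorem lieDerivForm_flat_apply (g : PseudoRiemannianMetric n M)
    {X Y Z : Π x : M, TangentSpace (𝓡 n) x} (hY : IsSmoothField Y) (hZ : IsSmoothField Z) (x : M) :
    lieDerivForm X (g.flat Y) x (Z x) = mvfderiv (𝓡 n) (fun y ↦ g.form y (Y y) (Z y)) x (X x) -
      g.form x (Y x) (VectorField.mlieBracket (𝓡 n) X Z x) :=
  lieDerivForm_apply (fun _ h ↦ g.mdifferentiableAt_form (hY.diffFieldAt x) h) (hZ.diffFieldAt x)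

end PseudoRiemannianMetric

namespace WittStructure

section

variable {g : PseudoRiemannianMetric n M} {r s : ℕ} (W : WittStructure g r s)

theorem proj_mem (i : WittIndex r s) (x : M) (v : TangentSpace (𝓡 n) x) :
    W.proj i x v ∈ W.V i x :=
  SetLike.coe_mem _

theorem sum_proj (x : M) (v : TangentSpace (𝓡 n) x) : ∑ i, W.proj i x v = v := by
  classical
  have h : DirectSum.coeLinearMap (fun k ↦ W.V k x)
      ((LinearEquiv.ofBijective (DirectSum.coeLinearMap fun k ↦ W.V k x)
        (W.isInternal x)).symm v) = v :=
    (LinearEquiv.ofBijective (DirectSum.coeLinearMap fun k ↦ W.V k x)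
      (W.isInternal x)).apply_symm_apply v
  rw [DirectSum.coeLinearMap_eq_dfinsuppSum,
    DFinsupp.sum_eq_sum_fintype _ (by simp)] at h
  exact h

/-- Isotropy covers `j = i` and block orthogonality the rest: a null summand pairs only with its
dual. -/
theorem form_eq_zero {i j : WittIndex r s} (hi : i.dual ≠ i) (hj : j ≠ i.dual) {x : M}
    {v w : TangentSpace (𝓡 n) x} (hv : v ∈ W.V i x) (hw : w ∈ W.V j x) : g.form x v w = 0 := by
  by_cases h : j = i
  · subst h
    exact W.isotropic j hi x v w hv hw
  · exact W.orthogonal i j h hj x v w hv hw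

theorem form_proj {i : WittIndex r s} (hi : i.dual ≠ i) {x : M} {v : TangentSpace (𝓡 n) x}
    (hv : v ∈ W.V i x) (w : TangentSpace (𝓡 n) x) :
    g.form x v (W.proj i.dual x w) = g.form x v w := by
  conv_rhs => rw [← W.sum_proj x w, map_sum]
  rw [Finset.sum_eq_single i.dual]
  · intro j _ hj
    exact W.form_eq_zero hi hj hv (W.proj_mem j x w)
  · simp

theorem form_projPerp {i : WittIndex r s} (hi : i.dual ≠ i) {x : M} {v : TangentSpace (𝓡 n) x}
    (hv : v ∈ W.V i x) (w : TangentSpace (𝓡 n) x) :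
    g.form x v (W.projPerp i i.dual x w) = 0 := by
  rw [projPerp, map_sum]
  refine Finset.sum_eq_zero fun j hj ↦ ?_
  exact W.form_eq_zero hi (Finset.mem_filter.1 hj).2.2 hv (W.proj_mem j x w)

theorem _root_.WittGeometry.WittIndex.dual_dual (i : WittIndex r s) : i.dual.dual = i := by
  cases i <;> rfl

variable {nabla : CovariantDerivative (𝓡 n) (EuclideanSpace ℝ (Fin n))
  (TangentSpace (𝓡 n) : M → Type _)} {X Y : Π x : M, TangentSpace (𝓡 n) x}

/-- The torsion of the canonical Witt connection has no components in the hyperbolic plane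
spanned by two dual null sections. -/
theorem IsCanonicalWittConnection.form_torsion (hnabla : W.IsCanonicalWittConnection nabla)
    {i : WittIndex r s} (hi : i.dual ≠ i) (hX : W.IsSection i X) (hY : W.IsSection i.dual Y)
    (hXY : ∀ x, g.form x (X x) (Y x) = 1) (x : M) :
    g.form x (X x) (nabla.torsion x (X x) (Y x)) = 0 := by
  have hconst : (fun y ↦ g.form y (X y) (Y y)) = fun _ ↦ 1 := funext hXY
  have hnull : (fun y ↦ g.form y (X y) (X y)) = fun _ ↦ 0 :=
    funext fun y ↦ W.isotropic i hi y _ _ (hX.2 y) (hX.2 y)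
  have hsharp (θ : TangentSpace (𝓡 n) x →L[ℝ] ℝ) : g.form x (X x) (g.sharp x θ) = θ (X x) := by
    rw [g.symm, g.form_sharp]
  have h1 : lieDerivForm X (g.flat Y) x (X x) = 0 := by
    rw [g.lieDerivForm_flat_apply hY.1 hX.1, VectorField.mlieBracket_self]
    simp only [g.symm _ (Y _) (X _), hconst, mvfderiv_const]
    simp
  have h2 : lieDerivForm Y (g.flat X) x (X x) =
      g.form x (X x) (VectorField.mlieBracket (𝓡 n) X Y x) := by
    rw [g.lieDerivForm_flat_apply hX.1 hX.1, hnull, mvfderiv_const,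
      VectorField.mlieBracket_swap_apply]
    simp
  -- `τ^i` takes values in `V_i`, which is isotropic.
  have h3 : g.form x (X x) (W.tau i i.dual i Y X x) = 0 := by
    refine W.form_eq_zero hi hi.symm (hX.2 x) ?_
    unfold tau
    split_ifs
    · exact Submodule.zero_mem _
    · exact Submodule.smul_mem _ _ (Submodule.sub_mem _ (Submodule.sub_mem _ (W.proj_mem _ _ _)
        (W.proj_mem _ _ _)) (W.proj_mem _ _ _))
    · exact Submodule.smul_mem _ _ (Submodule.sub_mem _ (W.proj_mem _ _ _) (W.proj_mem _ _ _))
  -- Pairing with `X` undoes the projection to `V_{i*}`. Then `h2` cancels the bracket term, and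
  -- `h1` and the constancy of `g(X, Y)` remove the others.
  have h4 : g.form x (X x) (W.tau i.dual i i.dual X Y x) = 0 := by
    rw [tau, if_neg (by simp [hi.symm]), if_pos (WittIndex.dual_dual i).symm]
    simp only [map_smul, map_sub, W.form_proj hi (hX.2 x), hsharp, hconst, mvfderiv_const]
    simp [h1, h2]
  rw [hnabla.torsion_eq i i.dual X Y hX hY x]
  simp only [map_sub, map_add, map_neg, h3, h4, W.form_projPerp hi (hX.2 x)]
  simp

/-- Paired with `X`, the torsion `∇_X Y - ∇_Y X - [X, Y]` vanishes, and so does `∇_Y X`, which lies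
in the isotropic `V_i`. What remains is `g(X, [X, Y])`, a Lie derivative because `g(X, X) = 0`. -/
theorem IsCanonicalWittConnection.form_nabla_dual (hnabla : W.IsCanonicalWittConnection nabla)
    {i : WittIndex r s} (hi : i.dual ≠ i) (hX : W.IsSection i X) (hY : W.IsSection i.dual Y)
    (hXY : ∀ x, g.form x (X x) (Y x) = 1) (x : M) :
    g.form x (X x) (nabla Y x (X x)) = lieDerivForm Y (g.flat X) x (X x) := by
  have hnull : (fun y ↦ g.form y (X y) (X y)) = fun _ ↦ 0 :=
    funext fun y ↦ W.isotropic i hi y _ _ (hX.2 y) (hX.2 y)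
  have h := hnabla.form_torsion W hi hX hY hXY x
  rw [nabla.torsion_apply (hX.1.diffFieldAt x) (hY.1.diffFieldAt x), map_sub, map_sub,
    W.isotropic i hi x _ _ (hX.2 x) (hnabla.preserves i X hX x (Y x))] at h
  rw [g.lieDerivForm_flat_apply hX.1 hX.1, hnull, mvfderiv_const,
    VectorField.mlieBracket_swap_apply]
  simp
  linarith

theorem lieDerivForm_dual_self (hX : IsSmoothField X) (hY : IsSmoothField Y)
    (hXY : ∀ x, g.form x (X x) (Y x) = 1) (x : M) :
    lieDerivForm Y (g.flat X) x (Y x) = 0 := by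
  rw [g.lieDerivForm_flat_apply hX hY, funext hXY, mvfderiv_const, VectorField.mlieBracket_self]
  simp

/-- Metric compatibility applied to the constant `g(X, Y)`: the connection forms of dual null lines
are opposite. -/
theorem IsWittConnection.form_nabla_add (hnabla : W.IsWittConnection nabla)
    (hX : IsSmoothField X) (hY : IsSmoothField Y)
    (hXY : ∀ x, g.form x (X x) (Y x) = 1) (x : M) (v : TangentSpace (𝓡 n) x) :
    g.form x (Y x) (nabla X x v) = - g.form x (X x) (nabla Y x v) := by
  have h := hnabla.metric X Y hX hY x v
  rw [funext hXY, mvfderiv_const, g.symm x (nabla X x v)] at h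
  simp at h
  linarith

end

/-! ### Coordinates in the null frame. -/

variable {g : PseudoRiemannianMetric n M} {W : WittStructure g 1 1}
  {ξ ξs : Π x : M, TangentSpace (𝓡 n) x}

namespace IsNullFrame

theorem isSection (hξ : W.IsNullFrame ξ ξs) : W.IsSection (.p 0) ξ :=
  ⟨hξ.smooth, fun x ↦ by rw [hξ.span]; exact Submodule.mem_span_singleton_self _⟩

theorem isSection_star (hξ : W.IsNullFrame ξ ξs) : W.IsSection (.pStar 0) ξs :=
  ⟨hξ.smooth_star, fun x ↦ by rw [hξ.span_star]; exact Submodule.mem_span_singleton_self _⟩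

theorem form_self (hξ : W.IsNullFrame ξ ξs) (x : M) : g.form x (ξ x) (ξ x) = 0 :=
  W.isotropic (.p 0) (by simp [WittIndex.dual]) x _ _ (hξ.isSection.2 x) (hξ.isSection.2 x)

theorem form_star_self (hξ : W.IsNullFrame ξ ξs) (x : M) : g.form x (ξs x) (ξs x) = 0 :=
  W.isotropic (.pStar 0) (by simp [WittIndex.dual]) x _ _ (hξ.isSection_star.2 x)
    (hξ.isSection_star.2 x)

theorem eq_smul_add_smul (hξ : W.IsNullFrame ξ ξs) {x : M} {v : TangentSpace (𝓡 n) x}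
    (hv : v ∈ W.V (.p 0) x ⊔ W.V (.pStar 0) x) :
    v = g.form x (ξs x) v • ξ x + g.form x (ξ x) v • ξs x := by
  rw [hξ.span, hξ.span_star] at hv
  obtain ⟨y, hy, z, hz, rfl⟩ := Submodule.mem_sup.1 hv
  obtain ⟨a, rfl⟩ := Submodule.mem_span_singleton.1 hy
  obtain ⟨b, rfl⟩ := Submodule.mem_span_singleton.1 hz
  simp [hξ.form_self, hξ.form_star_self, hξ.normalized, g.symm x (ξs x) (ξ x)]

end IsNullFrame

end WittStructure

end

end WittGeometry

/-! ### The geodesic equations in the null frame. -/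

open WittGeometry in
/-- Here `σ = (ξ*)♭` and `σ* = ξ♭`. -/
theorem proposition4p1 {n : ℕ} {M : Type*} [TopologicalSpace M] [T2Space M]
    [SecondCountableTopology M] [ChartedSpace (EuclideanSpace ℝ (Fin n)) M]
    [IsManifold (𝓡 n) ∞ M]
    (g : PseudoRiemannianMetric n M) (W : WittStructure g 1 1)
    (hpos : ∀ (x : M) (v : TangentSpace (𝓡 n) x), v ∈ W.V (.q 0) x → v ≠ 0 → 0 < g.form x v v)
    (ξ ξs : Π x : M, TangentSpace (𝓡 n) x) (hξ : W.IsNullFrame ξ ξs)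
    (nabla : CovariantDerivative (𝓡 n) (EuclideanSpace ℝ (Fin n))
      (TangentSpace (𝓡 n) : M → Type _))
    (hnabla : W.IsCanonicalWittConnection nabla)
    (c : ℝ → M) (hc : ContMDiffOn 𝓘(ℝ, ℝ) (𝓡 n) ∞ c (Set.Icc 0 1))
    (htangent : ∀ t ∈ Set.Icc (0 : ℝ) 1,
      velocity c t ∈ W.V (.p 0) (c t) ⊔ W.V (.pStar 0) (c t))
    (hnull : ∀ t ∈ Set.Icc (0 : ℝ) 1, g.form (c t) (velocity c t) (velocity c t) = 0) :
    W.IsLightlikeGeodesic nabla c ↔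
      ∀ t ∈ Set.Icc (0 : ℝ) 1,
        lieDerivSelf c (g.flat ξs) t -
            g.flat ξs (c t) (velocity c t) *
              lieDerivForm ξs (g.flat ξ) (c t) (velocity c t) = 0 ∧
        lieDerivSelf c (g.flat ξ) t -
            g.flat ξ (c t) (velocity c t) *
              lieDerivForm ξ (g.flat ξs) (c t) (velocity c t) = 0 := by
  have hgeod : W.IsLightlikeGeodesic nabla c ↔ IsGeodesic nabla c :=
    ⟨fun h ↦ h.1, fun h ↦ ⟨h, htangent, hnull⟩⟩
  rw [hgeod]
  refine forall₂_congr fun t ht ↦ ?_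
  have hs := hξ.isSection
  have hss := hξ.isSection_star
  have hstar (x : M) : g.form x (ξs x) (ξ x) = 1 := by rw [g.symm, hξ.normalized]
  have hi : (WittIndex.p 0 : WittIndex 1 1).dual ≠ .p 0 := by simp [WittIndex.dual]
  have hi' : (WittIndex.pStar 0 : WittIndex 1 1).dual ≠ .pStar 0 := by simp [WittIndex.dual]
  have hcov := covDerivAlong_smul_add_smul nabla ht
    ((hc t ht).mdifferentiableWithinAt (by simp)) (hs.1.diffFieldAt _) (hss.1.diffFieldAt _)
    (g.differentiableWithinAt_form_velocity hss.1 hc ht)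
    (g.differentiableWithinAt_form_velocity hs.1 hc ht)
    (fun u hu ↦ hξ.eq_smul_add_smul (htangent u hu))
  have hmem : covDerivAlong nabla c (velocity c) t ∈
      W.V (.p 0) (c t) ⊔ W.V (.pStar 0) (c t) := by
    rw [hcov]
    refine Submodule.add_mem_sup ?_ ?_
    · exact Submodule.add_mem _ (Submodule.smul_mem _ _ (hs.2 _))
        (Submodule.smul_mem _ _ (hnabla.preserves _ _ hs _ _))
    · exact Submodule.add_mem _ (Submodule.smul_mem _ _ (hss.2 _))
        (Submodule.smul_mem _ _ (hnabla.preserves _ _ hss _ _))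
  -- Since `∇_ċ ċ` stays in the null plane, its pairings with `ξ*` and `ξ` are all of its
  -- coordinates.
  have hiff : covDerivAlong nabla c (velocity c) t = 0 ↔
      g.form (c t) (ξs (c t)) (covDerivAlong nabla c (velocity c) t) = 0 ∧
      g.form (c t) (ξ (c t)) (covDerivAlong nabla c (velocity c) t) = 0 := by
    refine ⟨fun h ↦ by simp [h], fun h ↦ ?_⟩
    rw [hξ.eq_smul_add_smul hmem, h.1, h.2]
    simp
  have hv := hξ.eq_smul_add_smul (htangent t ht)
  -- In the null frame, `g(ċ, ċ)` is twice this product.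
  have hab : g.form (c t) (ξs (c t)) (velocity c t) * g.form (c t) (ξ (c t)) (velocity c t) = 0 := by
    have h := hnull t ht
    rw [hv] at h
    simp [hξ.form_self, hξ.form_star_self, hξ.normalized, hstar] at h
    linarith
  have e1 := hnabla.form_nabla_dual W hi hs hss hξ.normalized (c t)
  have e2 := hnabla.form_nabla_dual W hi' hss hs hstar (c t)
  have e3 := WittStructure.lieDerivForm_dual_self hs.1 hss.1 hξ.normalized (c t)
  have e4 := WittStructure.lieDerivForm_dual_self hss.1 hs.1 hstar (c t)
  have e5 := fun v ↦ hnabla.form_nabla_add W hs.1 hss.1 hξ.normalized (c t) v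
  have e6 : ∀ v, g.form (c t) (ξ (c t)) (nabla ξ (c t) v) = 0 := fun v ↦
    W.isotropic _ hi _ _ _ (hs.2 _) (hnabla.preserves _ _ hs _ v)
  have e7 : ∀ v, g.form (c t) (ξs (c t)) (nabla ξs (c t) v) = 0 := fun v ↦
    W.isotropic _ hi' _ _ _ (hss.2 _) (hnabla.preserves _ _ hss _ v)
  have hlie (θ : TangentSpace (𝓡 n) (c t) →L[ℝ] ℝ) : θ (velocity c t) =
      g.form (c t) (ξs (c t)) (velocity c t) * θ (ξ (c t)) +
      g.form (c t) (ξ (c t)) (velocity c t) * θ (ξs (c t)) := by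
    conv_lhs => rw [hv]
    simp
  have hω := hlie ((g.form (c t) (ξ (c t))).comp (nabla ξs (c t)))
  simp only [ContinuousLinearMap.comp_apply] at hω
  have hD : g.form (c t) (ξs (c t)) (covDerivAlong nabla c (velocity c) t) =
      lieDerivSelf c (g.flat ξs) t + g.form (c t) (ξs (c t)) (velocity c t) *
        g.form (c t) (ξs (c t)) (nabla ξ (c t) (velocity c t)) := by
    rw [hcov]
    simp [e7, hstar, hξ.form_star_self, lieDerivSelf, PseudoRiemannianMetric.flat]
  have hDs : g.form (c t) (ξ (c t)) (covDerivAlong nabla c (velocity c) t) =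
      lieDerivSelf c (g.flat ξ) t + g.form (c t) (ξ (c t)) (velocity c t) *
        g.form (c t) (ξ (c t)) (nabla ξs (c t) (velocity c t)) := by
    rw [hcov]
    simp [e6, hξ.normalized, hξ.form_self, lieDerivSelf, PseudoRiemannianMetric.flat]
  -- Expresses everything through the single form `κ = g(ξ, ∇ξ*)`.
  rw [e5] at e2
  rw [hiff, hD, hDs, e5, hω, hlie (lieDerivForm ξs (g.flat ξ) (c t)),
    hlie (lieDerivForm ξ (g.flat ξs) (c t)), e3, e4, ← e1, ← e2]
  simp only [PseudoRiemannianMetric.flat]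
  refine and_congr (Eq.congr_left ?_) (Eq.congr_left ?_)
  -- The sides differ by the cross term `-a b κ(ξ*)`; in the second equation it is `a b κ(ξ)`.
  · linear_combination
      -g.form (c t) (ξ (c t)) (nabla ξs (c t) (ξs (c t))) * hab
  · linear_combination
      g.form (c t) (ξ (c t)) (nabla ξs (c t) (ξ (c t))) * hab
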